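/- A BL-algebra is an algebra $(L,\otimes,\to,0,1)$ such that $(L,\otimes,1)$ is a commutative monoid and, for all $x,y,z\in L$: $x\to x=1$; $x\otimes(x\to y)=y\otimes(y\to x)$; $x\to(y\to z)=(x\otimes y)\to z$; $0\le x$; and $(x\to y)\to z\le((y\to x)\to z)\to z$, where $x\le y$ means $x\to y=1$. Write $x\wedge y=x\otimes(x\to y)$, $\bar x=x\to 0$ and $$x+y:=(\bar x\to y)\wedge(\bar y\to x).$$ A BL-chain is a BL-algebra in which $\le$ is total. A BL-chain is of cancellative type if, for all $x,y,z$ in it, $x+y=x+z$ and $x\otimes y=x\otimes z$ imply $y=z$. A BL-algebra is of cancellative type if it is (isomorphic to) a subdirect product of BL-chains of cancellative type. A good sequence in $L$ is a sequence $\mathbf a=(a_1,a_2,\ldots)$ of elements of $L$ such that $a_i+a_{i+1}=a_i$ for all $i\ge1$ and $a_r=0$ for all sufficiently large $r$. Let $M_L$ be the set of good sequences in $L$. The sum of two sequences $\mathbf a,\mathbf b$ in $L$ is the sequence $\mathbf a+\mathbf b=(c_1,c_2,\ldots)$ with $$c_i:=a_i+(a_{i-1}\otimes b_1)+\cdots+(a_1\otimes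 b_{i-1})+b_i ,$$ where the iterated addition in $L$ is bracketed to the left. **Proposition.** If $L$ is a BL-algebra of cancellative type, then $(M_L,+)$ is a cancellative commutative monoid whose neutral element is the zero sequence $(0,0,\ldots)$. That is: the sum of two good sequences is a good sequence, the addition of good sequences is associative and commutative with neutral element $(0,0,\ldots)$, and for all good sequences $\mathbf a,\mathbf b,\mathbf c$ in $L$, $\mathbf a+\mathbf c=\mathbf b+\mathbf c$ implies $\mathbf a=\mathbf b$. -/

import Mathlib

universe u

/-- A hoop `(A, ⊗, →, 1)`; the product `⊗` is written `*` and the implication `→` is written `⇨`. -/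
class Hoop (A : Type u) extends CommMonoid A, HImp A where
  himp_self_eq : ∀ x : A, x ⇨ x = 1
  mul_himp_comm : ∀ x y : A, x * (x ⇨ y) = y * (y ⇨ x)
  himp_himp_eq : ∀ x y z : A, x ⇨ (y ⇨ z) = (x * y) ⇨ z

/-- The natural order of a hoop: `x ≤ y` iff `x → y = 1`. -/
def Hoop.Le {A : Type u} [Hoop A] (x y : A) : Prop := x ⇨ y = 1

/-- The meet of a hoop for its natural order: `x ∧ y = x ⊗ (x → y)`. -/
def Hoop.meet {A : Type u} [Hoop A] (x y : A) : A := x * (x ⇨ y)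

/-- A BL-algebra: a hoop with a minimum `0` satisfying
`(x → y) → z ≤ ((y → x) → z) → z`. -/
class BLAlgebra (A : Type u) extends Hoop A, Zero A where
  zero_le : ∀ x : A, Hoop.Le 0 x
  prelinear : ∀ x y z : A, Hoop.Le ((x ⇨ y) ⇨ z) (((y ⇨ x) ⇨ z) ⇨ z)

namespace BLAlgebra

/-- The complement `x → 0`. -/
def neg {L : Type u} [BLAlgebra L] (x : L) : L := x ⇨ 0

/-- The pseudo-addition: the complement of `x` implies `y`. -/
def oslash {L : Type u} [BLAlgebra L] (x y : L) : L := neg x ⇨ y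

/-- The addition of a BL-algebra: `x + y = (x ⊘ y) ∧ (y ⊘ x)`. -/
def plus {L : Type u} [BLAlgebra L] (x y : L) : L := Hoop.meet (oslash x y) (oslash y x)

/-- A BL-chain is a BL-algebra whose natural order is total. -/
def IsBLChain (L : Type u) [BLAlgebra L] : Prop :=
  ∀ x y : L, Hoop.Le x y ∨ Hoop.Le y x

/-- A BL-chain of cancellative type: `x + y = x + z` and `x ⊗ y = x ⊗ z` imply `y = z`. -/
def IsCancellativeChain (L : Type u) [BLAlgebra L] : Prop :=
  IsBLChain L ∧ ∀ x y z : L, plus x y = plus x z → x * y = x * z → y = z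

/-- Homomorphisms of BL-algebras. -/
structure IsHom {L : Type u} {C : Type u} [BLAlgebra L] [BLAlgebra C] (f : L → C) : Prop where
  map_mul : ∀ x y : L, f (x * y) = f x * f y
  map_himp : ∀ x y : L, f (x ⇨ y) = f x ⇨ f y
  map_one : f 1 = 1
  map_zero : f 0 = 0

/-- `L` is of cancellative type: it is (isomorphic to) a subdirect product of BL-chains of
cancellative type. The `π i` are the components of the embedding of `L` into the product of the
`C i`: each is a surjective homomorphism, and together they separate points. Since each `C i` is
a quotient of `L`, and since chains that occur more than once may be discarded, taking `ι` and
the `C i` in the universe of `L` is no restriction. -/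
def IsOfCancellativeType (L : Type u) [BLAlgebra L] : Prop :=
  ∃ (ι : Type u) (C : ι → Type u) (_ : ∀ i, BLAlgebra (C i)) (π : ∀ i, L → C i),
    (∀ i, IsCancellativeChain (C i)) ∧
    (∀ i, IsHom (π i)) ∧
    (∀ i, Function.Surjective (π i)) ∧
    Function.Injective (fun (x : L) (i : ι) => π i x)

/-- Good sequences. Sequences are indexed from `0`: `a 0` is the first entry. -/
def IsGoodSeq {L : Type u} [BLAlgebra L] (a : ℕ → L) : Prop :=
  (∀ n, plus (a n) (a (n + 1)) = a n) ∧ ∃ N, ∀ n, N < n → a n = 0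

/-- The iterated addition `x + t 0 + t 1 + ⋯ + t (k - 1)`, bracketed to the left. -/
def iterPlus {L : Type u} [BLAlgebra L] (x : L) (t : ℕ → L) : ℕ → L
  | 0 => x
  | k + 1 => plus (iterPlus x t k) (t k)

/-- The sum of two sequences; indexed from `0`, its entry at `n` is
`a n + (a (n-1) ⊗ b 0) + (a (n-2) ⊗ b 1) + ⋯ + (a 0 ⊗ b (n-1)) + b n`.
In the iterated addition only the terms with `j < n` occur, so the subtraction is exact. -/
def seqAdd {L : Type u} [BLAlgebra L] (a b : ℕ → L) : ℕ → L := fun n =>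
  plus (iterPlus (a n) (fun j => a (n - 1 - j) * b j) n) (b n)

/-- The set `M_L` of good sequences of `L`. -/
def GoodSeq (L : Type u) [BLAlgebra L] : Type u := {a : ℕ → L // IsGoodSeq a}

end BLAlgebra

/-! Homomorphisms respect the addition of sequences and those onto the factors separate points, so
all identities and cancellation can be checked in a chain of cancellative type. Such a chain is an
MV-chain, or all its nonzero elements are dense (`IsCancellativeChain.involutive_or_strict`); either
way x + y = 1 or x ⊗ y = 0. Hence a good sequence in the chain is 1, …, 1, a, 0, 0, …, and two of
these add up to 1, …, 1, a + b, a ⊗ b, 0, …, the numbers of leading ones being added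
(`seqAdd_stepSeq`). Cancellation then reduces to the defining condition of cancellative type.
Associativity reduces to that of + and ⊗ and to `IsCancellativeChain.mul_plus_plus_mul`, whose MV
case rests on u ⊗ c being the only t with ¬c + t = u when ¬c ≤ u ≠ 1. -/

namespace Hoop

/-! ### Arithmetic and order of hoops -/

variable {A : Type u} [Hoop A]

theorem one_himp_himp (x y : A) : (1 : A) ⇨ (x ⇨ y) = x ⇨ y := by
  rw [himp_himp_eq, one_mul]

/-- Neither 1 → x = x nor x → 1 = 1 is an axiom. This weak form yields the former, which then yields
the latter. -/
theorem himp_one_himp_one (x : A) : (x ⇨ (1 : A)) ⇨ (1 : A) = 1 := by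
  have h : (x ⇨ (1 : A)) = (x ⇨ (1 : A)) * ((x ⇨ (1 : A)) ⇨ (1 : A)) := by
    rw [← mul_himp_comm, one_himp_himp, one_mul]
  calc (x ⇨ (1 : A)) ⇨ (1 : A)
      = (((x ⇨ (1 : A)) ⇨ (1 : A)) * (x ⇨ (1 : A))) ⇨ (1 : A) := by
        rw [mul_comm, ← h]
    _ = 1 := by rw [← himp_himp_eq, himp_self_eq]

theorem eq_of_himp_eq_one {x y : A} (h : x ⇨ y = 1) (h' : y ⇨ x = 1) : x = y := by
  have := mul_himp_comm x y
  rwa [h, h', mul_one, mul_one] at this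

theorem one_himp (x : A) : (1 : A) ⇨ x = x := by
  apply eq_of_himp_eq_one
  · have : (1 : A) ⇨ x = x * (x ⇨ 1) := by rw [← mul_himp_comm, one_mul]
    rw [this, mul_comm, ← himp_himp_eq, himp_self_eq, himp_one_himp_one]
  · rw [himp_himp_eq, mul_one, himp_self_eq]

theorem himp_one (x : A) : x ⇨ (1 : A) = 1 := by
  rw [← one_himp (x ⇨ (1 : A))]
  have h : x * (x ⇨ 1) = x := by rw [← mul_himp_comm, one_mul, one_himp]
  have : x ⇨ (1 : A) = (x * (x ⇨ 1)) ⇨ 1 := by rw [h]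
  rw [this, mul_comm, ← himp_himp_eq, himp_self_eq, one_himp]

/-- The natural order of a hoop. -/
instance : PartialOrder A where
  le := Le
  le_refl := himp_self_eq
  le_antisymm _ _ := eq_of_himp_eq_one
  le_trans x y z hxy hyz := by
    change x ⇨ z = 1
    change x ⇨ y = 1 at hxy
    change y ⇨ z = 1 at hyz
    have : x = y * (y ⇨ x) := by rw [← mul_himp_comm, hxy, mul_one]
    rw [this, mul_comm, ← himp_himp_eq, hyz, himp_one]

theorem le_iff {x y : A} : x ≤ y ↔ x ⇨ y = 1 := Iff.rfl

theorem le_himp_iff {x y z : A} : x ≤ y ⇨ z ↔ x * y ≤ z := by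
  rw [le_iff, le_iff, himp_himp_eq]

theorem le_one (x : A) : x ≤ 1 := himp_one x

theorem mul_mono_left {x y : A} (h : x ≤ y) (z : A) : x * z ≤ y * z :=
  le_himp_iff.1 (h.trans (le_himp_iff.2 le_rfl))

theorem mul_le_left (x y : A) : x * y ≤ x := by
  have := mul_mono_left (le_one y) x
  rwa [one_mul, mul_comm] at this

theorem mul_le_right (x y : A) : x * y ≤ y := by
  rw [mul_comm]; exact mul_le_left y x

theorem mul_himp_of_le {x y : A} (h : y ≤ x) : x * (x ⇨ y) = y := by
  rw [mul_himp_comm, le_iff.1 h, mul_one]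

theorem le_meet {x y z : A} (h : z ≤ x) (h' : z ≤ y) : z ≤ meet x y := by
  have h1 : x * (x ⇨ z) ≤ x * (x ⇨ y) := by
    rw [mul_comm x, mul_comm x]
    refine mul_mono_left (le_himp_iff.2 (le_trans ?_ h')) x
    rw [mul_comm, mul_himp_of_le h]
  rwa [mul_himp_of_le h] at h1

theorem one_meet (x : A) : meet 1 x = x := by
  rw [meet, one_himp, one_mul]

end Hoop

namespace BLAlgebra

open Hoop

/-! ### Complement and addition in BL-algebras -/

section Basic

variable {L : Type u} [BLAlgebra L]

theorem bot_le (x : L) : 0 ≤ x := zero_le x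

theorem eq_zero_of_le {x : L} (h : x ≤ 0) : x = 0 := le_antisymm h (bot_le x)

theorem mul_bot (x : L) : x * 0 = 0 := eq_zero_of_le (mul_le_right x 0)

theorem bot_mul (x : L) : 0 * x = 0 := eq_zero_of_le (mul_le_left 0 x)

theorem neg_zero : neg (0 : L) = 1 := himp_self_eq 0

theorem neg_one : neg (1 : L) = 0 := one_himp 0

theorem le_neg_iff {x y : L} : x ≤ neg y ↔ x * y = 0 := by
  rw [neg, Hoop.le_himp_iff]
  exact ⟨eq_zero_of_le, fun h => h.le⟩

theorem mul_neg (x : L) : x * neg x = 0 := by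
  rw [mul_comm, ← le_neg_iff]

theorem le_neg_neg (x : L) : x ≤ neg (neg x) := le_neg_iff.2 (mul_neg x)

theorem neg_le_neg {x y : L} (h : x ≤ y) : neg y ≤ neg x := by
  rw [le_neg_iff]
  apply eq_zero_of_le
  rw [mul_comm, ← mul_neg y]
  exact mul_mono_left h _

theorem himp_neg (x y : L) : x ⇨ neg y = neg (x * y) := himp_himp_eq x y 0

theorem plus_comm (x y : L) : plus x y = plus y x := mul_himp_comm _ _

theorem plus_zero (x : L) : plus x 0 = x := by
  have h : neg x ⇨ (0 : L) = neg (neg x) := rfl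
  rw [plus, oslash, oslash, neg_zero, one_himp, h, meet, mul_himp_of_le (le_neg_neg x)]

theorem zero_plus (x : L) : plus 0 x = x := by
  rw [plus_comm, plus_zero]

theorem plus_one (x : L) : plus x 1 = 1 := by
  rw [plus, oslash, oslash, neg_one, himp_one, one_meet]
  exact bot_le x

theorem one_plus (x : L) : plus 1 x = 1 := by
  rw [plus_comm, plus_one]

theorem le_plus_right (x y : L) : y ≤ plus x y := by
  apply le_meet
  · exact le_himp_iff.2 (mul_le_left _ _)
  · refine le_himp_iff.2 ?_
    rw [mul_neg]
    exact bot_le x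

theorem eq_of_zero_eq_one (h : (0 : L) = 1) (x y : L) : x = y :=
  (eq_zero_of_le (h ▸ le_one x)).trans (eq_zero_of_le (h ▸ le_one y)).symm

theorem plus_eq_one_of_neg_eq_zero {x y : L} (hx : neg x = 0) (hy : neg y = 0) :
    plus x y = 1 := by
  have h : ∀ z : L, (0 : L) ⇨ z = 1 := zero_le
  rw [plus, oslash, oslash, hx, hy, h, h, one_meet]

end Basic

/-! ### Structure of chains of cancellative type -/

section Chain

variable {C : Type u} [BLAlgebra C]

/-- In a BL-chain, `¬¬x → x` is dense. -/
theorem neg_neg_neg_himp_self (hC : IsBLChain C) (x : C) : neg (neg (neg x) ⇨ x) = 0 := by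
  have hx : neg (neg x) * (neg (neg x) ⇨ x) = x := mul_himp_of_le (le_neg_neg x)
  have hxd : x ≤ neg (neg x) ⇨ x := le_himp_iff.2 (mul_le_left _ _)
  generalize hd : neg (neg x) ⇨ x = d at *
  rcases hC (neg x) d with h | h
  -- Here d → ¬x = ¬x, so divisibility gives ¬x ⊗ d = ¬x. As ¬d ≤ ¬x, it follows that ¬d = ¬x ⊗ ¬(¬x
  -- ⊗ d) = ¬x ⊗ ¬¬x = 0.
  · have h1 : d ⇨ neg (neg (neg x)) = neg x := by
      rw [himp_neg, mul_comm, hx]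
    have h2 : neg (neg (neg x)) = neg x :=
      le_antisymm (neg_le_neg (le_neg_neg x)) (le_neg_neg _)
    have h3 : neg x * d = neg x := by
      rw [h2] at h1
      have := mul_himp_of_le h
      rwa [h1, mul_comm] at this
    have h4 := mul_himp_of_le (neg_le_neg hxd)
    rw [himp_neg, h3, mul_neg] at h4
    exact h4.symm
  · have h1 : x = 0 := by
      rw [← hx, mul_comm, ← le_neg_iff]
      exact le_trans h (le_neg_neg _)
    rw [← hd, h1, neg_zero, neg_one, himp_self_eq, neg_one]

/-- In a BL-chain, a dense element is above the complement of each nonzero element. -/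
theorem neg_le_of_neg_eq_zero (hC : IsBLChain C) {d v : C} (hd : neg d = 0) (hv : v ≠ 0) :
    neg v ≤ d := by
  rcases hC (neg v) d with h | h
  · exact h
  · refine absurd (eq_zero_of_le ?_) hv
    rw [← hd]
    exact (le_neg_neg v).trans (neg_le_neg h)

/-- A chain of cancellative type is an MV-chain, or all its nonzero elements are dense. -/
theorem IsCancellativeChain.involutive_or_strict (hC : IsCancellativeChain C) :
    (∀ x : C, neg (neg x) = x) ∨ ∀ x : C, x ≠ 0 → neg x = 0 := by
  by_contra! hcon
  obtain ⟨⟨z, hz⟩, v, hv, hnv⟩ := hcon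
  apply hz
  have hd := neg_neg_neg_himp_self hC.1 z
  have hle := le_neg_neg z
  suffices h : neg (neg z) ⇨ z = 1 by exact le_antisymm h hle
  generalize neg (neg z) ⇨ z = d at hd
  have h1 := neg_le_of_neg_eq_zero hC.1 hd hv
  have h2 : neg v * d = neg v := by
    have h := mul_himp_of_le h1
    have h' : d * v = v * d := mul_comm _ _
    rwa [himp_neg, h', ← himp_neg, hd, mul_comm] at h
  -- The dense d and 1 have the same product with ¬v, namely ¬v, and the same sum, namely 1;
  -- cancelling ¬v gives d = 1.
  refine hC.2 (neg v) d 1 ?_ (by rw [h2, mul_one])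
  have h3 : neg (neg v) ⇨ d = 1 := neg_le_of_neg_eq_zero hC.1 hd hnv
  have h4 : (0 : C) ⇨ neg v = 1 := bot_le _
  rw [plus_one, plus, oslash, oslash, hd, h3, h4, one_meet]

section Involutive

variable (hi : ∀ x : C, neg (neg x) = x)
include hi

theorem plus_eq_neg_mul (x y : C) : plus x y = neg (neg x * neg y) := by
  have h : ∀ x y : C, oslash x y = neg (neg x * neg y) := fun x y => by
    rw [oslash, ← himp_neg, hi]
  rw [plus, h, h, mul_comm (neg y), meet, himp_self_eq, mul_one]

theorem neg_plus_of_involutive (x y : C) : neg (plus x y) = neg x * neg y := by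
  rw [plus_eq_neg_mul hi, hi]

theorem plus_assoc_of_involutive (x y z : C) : plus (plus x y) z = plus x (plus y z) := by
  rw [plus_eq_neg_mul hi, neg_plus_of_involutive hi, plus_eq_neg_mul hi x,
    neg_plus_of_involutive hi, mul_assoc]

theorem plus_eq_one_iff {x y : C} : plus x y = 1 ↔ neg x ≤ y := by
  rw [plus_eq_neg_mul hi, ← himp_neg, hi]
  rfl

/-- The left side is the complement of c ∧ ¬u, which is ¬u. Together with cancellation below 1, this
characterises u ⊗ c by a sum. -/
theorem neg_plus_mul {u c : C} (h : neg c ≤ u) : plus (neg c) (u * c) = u := by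
  have h' : neg u ≤ c := by simpa only [hi] using neg_le_neg h
  rw [plus_eq_neg_mul hi, hi, mul_comm u, ← himp_neg c u, mul_himp_comm, h', mul_one, hi]

end Involutive

theorem IsCancellativeChain.plus_eq_one_or_mul_eq_zero (hC : IsCancellativeChain C) (x y : C) :
    plus x y = 1 ∨ x * y = 0 := by
  rcases hC.involutive_or_strict with hi | hs
  · rcases hC.1 (neg x) y with h | h
    · exact Or.inl ((plus_eq_one_iff hi).2 h)
    · exact Or.inr ((mul_comm _ _).trans (le_neg_iff.1 h))
  · by_cases hx : x = 0
    · exact Or.inr (hx ▸ bot_mul y)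
    by_cases hy : y = 0
    · exact Or.inr (hy ▸ mul_bot x)
    exact Or.inl (plus_eq_one_of_neg_eq_zero (hs x hx) (hs y hy))

/-- If the common sum is not 1, both products are 0, so the product condition in the definition
holds automatically. -/
theorem IsCancellativeChain.plus_left_cancel (hC : IsCancellativeChain C) {x y z : C}
    (h : plus x y = plus x z) (h1 : plus x y ≠ 1) : y = z := by
  refine hC.2 x y z h ?_
  rw [(hC.plus_eq_one_or_mul_eq_zero x y).resolve_left h1,
    (hC.plus_eq_one_or_mul_eq_zero x z).resolve_left (h ▸ h1)]

theorem IsCancellativeChain.plus_eq_left (hC : IsCancellativeChain C) {x y : C}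
    (h : plus x y = x) : x = 1 ∨ y = 0 := by
  by_cases hx : x = 1
  · exact Or.inl hx
  · exact Or.inr (hC.plus_left_cancel (h.trans (plus_zero x).symm) (by rwa [h]))

theorem IsCancellativeChain.plus_plus_mul (hC : IsCancellativeChain C) (x y : C) :
    plus (plus x y) (x * y) = plus x y := by
  rcases hC.plus_eq_one_or_mul_eq_zero x y with h | h
  · rw [h, one_plus]
  · rw [h, plus_zero]

/-- Adding ¬c to either side gives a + b, and ¬c can be cancelled because a + b ≠ 1. -/
theorem plus_mul_eq_plus_mul (hC : IsCancellativeChain C) (hi : ∀ x : C, neg (neg x) = x)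
    {a b c : C} (hab : plus a b ≠ 1) (hbc : plus b c = 1) :
    plus a b * c = plus a (b * c) := by
  have h1 : neg c ≤ b := by rwa [plus_comm, plus_eq_one_iff hi] at hbc
  have h2 := neg_plus_mul hi h1
  have h3 := neg_plus_mul hi (h1.trans (le_plus_right a b))
  refine hC.plus_left_cancel (x := neg c) ?_ (by rwa [h3])
  rw [h3, ← plus_assoc_of_involutive hi, plus_comm (neg c) a, plus_assoc_of_involutive hi, h2]

theorem plus_mul_eq_mul_plus (hC : IsCancellativeChain C) (hi : ∀ x : C, neg (neg x) = x)
    {a b c : C} (hab : plus a b ≠ 1) (hbc : plus b c ≠ 1) :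
    plus a b * c = a * plus b c := by
  have ha : a * b = 0 := (hC.plus_eq_one_or_mul_eq_zero a b).resolve_left hab
  have hb : b * c = 0 := (hC.plus_eq_one_or_mul_eq_zero b c).resolve_left hbc
  rcases hC.1 (neg c) (plus a b) with h | h
  -- Write ¬c = b + ¬(b + c) in ¬c + (a + b) ⊗ c = a + b and cancel b: then ¬(b + c) + (a + b) ⊗ c =
  -- a. The element a ⊗ (b + c) solves the same equation, and a ≠ 1.
  · have h1 := neg_plus_mul hi h
    have h2 : plus b (neg c * neg b) = neg c := by
      have := neg_plus_mul (u := neg c) (c := neg b) hi (by rw [hi]; exact le_neg_iff.2 hb)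
      rwa [hi] at this
    rw [← h2, plus_assoc_of_involutive hi, plus_comm a b] at h1
    have h3 := hC.plus_left_cancel h1 (by rwa [h1, plus_comm])
    rw [mul_comm (neg c), ← neg_plus_of_involutive hi, plus_comm b a] at h3
    have h4 : neg (plus b c) ≤ a :=
      (le_plus_right _ _).trans_eq ((plus_comm _ _).trans h3)
    refine hC.plus_left_cancel (h3.trans (neg_plus_mul hi h4).symm) ?_
    rw [h3]
    exact fun h => hab (h ▸ one_plus b)
  -- Both sides are 0: c ≤ ¬a ⊗ ¬b gives b + c ≤ b + (¬a ⊗ ¬b) = ¬a.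
  · have h1 : c ≤ neg a * neg b := by
      rw [← neg_plus_of_involutive hi, le_neg_iff, mul_comm]
      exact le_neg_iff.1 (show plus a b ≤ neg c from h)
    have h2 : plus b (neg a * neg b) = neg a := by
      have := neg_plus_mul (u := neg a) (c := neg b) hi
        (by rw [hi, le_neg_iff, mul_comm]; exact ha)
      rwa [hi] at this
    have h3 : plus b c ≤ neg a := by
      rw [← h2, plus_eq_neg_mul hi, plus_eq_neg_mul hi b, mul_comm, mul_comm (neg b)]
      exact neg_le_neg (mul_mono_left (neg_le_neg h1) _)
    rw [le_neg_iff.1 (show plus a b ≤ neg c from h), mul_comm, le_neg_iff.1 h3]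

theorem IsCancellativeChain.plus_assoc (hC : IsCancellativeChain C) (x y z : C) :
    plus (plus x y) z = plus x (plus y z) := by
  rcases hC.involutive_or_strict with hi | hs
  · exact plus_assoc_of_involutive hi x y z
  · by_cases hx : x = 0
    · rw [hx, zero_plus, zero_plus]
    by_cases hy : y = 0
    · rw [hy, zero_plus, plus_zero]
    by_cases hz : z = 0
    · rw [hz, plus_zero, plus_zero]
    rw [plus_eq_one_of_neg_eq_zero (hs x hx) (hs y hy),
      plus_eq_one_of_neg_eq_zero (hs y hy) (hs z hz), one_plus, plus_one]

/-- The second entries of `((a) + (b)) + (c)` and `(a) + ((b) + (c))` agree. -/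
theorem IsCancellativeChain.mul_plus_plus_mul (hC : IsCancellativeChain C) (a b c : C) :
    plus (a * b) (plus a b * c) = plus (b * c) (a * plus b c) := by
  rcases hC.involutive_or_strict with hi | hs
  · by_cases hab : plus a b = 1 <;> by_cases hbc : plus b c = 1
    · have h1 : neg b ≤ c := (plus_eq_one_iff hi).1 hbc
      have h2 : neg b ≤ a := (plus_eq_one_iff hi).1 (plus_comm a b ▸ hab)
      rw [hab, hbc, one_mul, mul_one]
      by_cases h3 : a * b = 0
      · rw [h3, zero_plus, le_antisymm (le_neg_iff.2 h3) h2, plus_comm, mul_comm,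
          neg_plus_mul hi h1]
      by_cases h4 : b * c = 0
      · rw [h4, zero_plus, le_antisymm (le_neg_iff.2 (by rwa [mul_comm])) h1, plus_comm,
          neg_plus_mul hi h2]
      -- Complementation exchanges + and ⊗, so the case of two nonzero products is dual to that of
      -- two sums below 1, applied to ¬a, ¬b, ¬c.
      have key : ∀ x y : C, x * y ≠ 0 → plus (neg x) (neg y) ≠ 1 := fun x y hxy h => hxy <| by
        rw [← neg_one, ← h, neg_plus_of_involutive hi, hi, hi]
      have h5 := plus_mul_eq_mul_plus hC hi (key a b h3) (key b c h4)
      rw [plus_eq_neg_mul hi, hi, hi, plus_eq_neg_mul hi, hi, hi] at h5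
      rw [plus_eq_neg_mul hi, h5, plus_eq_neg_mul hi, mul_comm]
    · have h1 : b * c = 0 := (hC.plus_eq_one_or_mul_eq_zero b c).resolve_left hbc
      have h2 := plus_mul_eq_plus_mul hC hi (a := c) (b := b) (c := a)
        (by rwa [plus_comm]) (by rwa [plus_comm])
      rw [hab, h1, zero_plus, one_mul, plus_comm, mul_comm a b, ← h2, plus_comm, mul_comm]
    · have h1 : a * b = 0 := (hC.plus_eq_one_or_mul_eq_zero a b).resolve_left hab
      rw [hbc, h1, zero_plus, mul_one, plus_comm (b * c), plus_mul_eq_plus_mul hC hi hab hbc]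
    · rw [(hC.plus_eq_one_or_mul_eq_zero a b).resolve_left hab,
        (hC.plus_eq_one_or_mul_eq_zero b c).resolve_left hbc,
        plus_mul_eq_mul_plus hC hi hab hbc]
  · by_cases ha : a = 0
    · simp only [ha, zero_plus, bot_mul, plus_zero]
    by_cases hb : b = 0
    · simp only [hb, zero_plus, bot_mul, plus_zero, mul_bot]
    by_cases hc : c = 0
    · simp only [hc, zero_plus, plus_zero, mul_bot]
    have hmul : ∀ x y : C, x ≠ 0 → y ≠ 0 → x * y ≠ 0 := fun x y hx hy hxy =>
      hx (eq_zero_of_le (hs y hy ▸ le_neg_iff.2 hxy))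
    have h1 : ∀ x y : C, x ≠ 0 → y ≠ 0 → plus x y = 1 := fun x y hx hy =>
      plus_eq_one_of_neg_eq_zero (hs x hx) (hs y hy)
    rw [h1 a b ha hb, h1 b c hb hc, one_mul, mul_one, h1 _ _ (hmul a b ha hb) hc,
      h1 _ _ (hmul b c hb hc) ha]

end Chain

/-! ### Iterated sums and the addition of step sequences -/

section IterPlus

variable {L : Type u} [BLAlgebra L]

theorem iterPlus_congr (x : L) {t t' : ℕ → L} {k : ℕ} (h : ∀ j < k, t j = t' j) :
    iterPlus x t k = iterPlus x t' k := by
  induction k with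
  | zero => rfl
  | succ k ih => rw [iterPlus, iterPlus, ih fun j hj => h j (by omega), h k (by omega)]

theorem iterPlus_succ_left (x : L) (t : ℕ → L) (k : ℕ) :
    iterPlus x t (k + 1) = iterPlus (plus x (t 0)) (fun j => t (j + 1)) k := by
  induction k with
  | zero => rfl
  | succ k ih => rw [iterPlus, ih, iterPlus]

theorem iterPlus_of_eq_zero (x : L) {t : ℕ → L} {k p : ℕ} (hpk : p ≤ k)
    (h : ∀ j, p ≤ j → j < k → t j = 0) : iterPlus x t k = iterPlus x t p := by
  induction k, hpk using Nat.le_induction with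
  | base => rfl
  | succ k hk ih =>
    rw [iterPlus, h k hk (by omega), plus_zero, ih fun j hj hjk => h j hj (by omega)]

theorem iterPlus_of_eq_one (x : L) {t : ℕ → L} {k p : ℕ} (hpk : p < k) (h : t p = 1) :
    iterPlus x t k = 1 := by
  induction k, hpk using Nat.le_induction with
  | base => rw [Nat.succ_eq_add_one, iterPlus, h, plus_one]
  | succ k hk ih => rw [iterPlus, ih, one_plus]

theorem iterPlus_eq_plus {t : ℕ → L} {k p : ℕ} (hpk : p + 1 < k)
    (h : ∀ j < k, j ≠ p → j ≠ p + 1 → t j = 0) :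
    iterPlus 0 t k = plus (t p) (t (p + 1)) := by
  rw [iterPlus_of_eq_zero (p := p + 2) 0 hpk
    (fun j hj hjk => h j hjk (by omega) (by omega)), iterPlus, iterPlus,
    iterPlus_of_eq_zero (p := 0) 0 (Nat.zero_le p)
    (fun j _ hjk => h j (by omega) (by omega) (by omega)), iterPlus, zero_plus]

/-- The sequence `1, a 0, a 1, …`. -/
def consOne (a : ℕ → L) : ℕ → L
  | 0 => 1
  | n + 1 => a n

/-- The sum of sequences as a convolution. -/
theorem seqAdd_eq_iterPlus (a b : ℕ → L) (n : ℕ) :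
    seqAdd a b n = iterPlus 0 (fun j => consOne a (n + 1 - j) * consOne b j) (n + 2) := by
  -- The end terms of the convolution, j = n + 1 and j = 0, are `b n` and `a n`; the inner terms are
  -- shifted by one.
  rw [iterPlus, iterPlus_succ_left, seqAdd]
  simp only [consOne, Nat.sub_self, one_mul, mul_one, Nat.sub_zero, zero_plus]
  congr 1
  refine iterPlus_congr _ fun j hj => ?_
  obtain ⟨d, rfl⟩ : ∃ d, n = j + 1 + d := ⟨n - (j + 1), by omega⟩
  rw [show j + 1 + d - 1 - j = d by omega, show j + 1 + d + 1 - (j + 1) = d + 1 by omega]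

/-- The sequence `1, …, 1, a, 0, 0, …` with `m` leading ones. -/
def stepSeq (m : ℕ) (a : L) (n : ℕ) : L := if n < m then 1 else if n = m then a else 0

/-- The sequence `1, …, 1, a, b, 0, 0, …` with `m` leading ones. -/
def stepSeqTwo (m : ℕ) (a b : L) (n : ℕ) : L :=
  if n < m then 1 else if n = m then a else if n = m + 1 then b else 0

theorem stepSeq_of_lt {m n : ℕ} (a : L) (h : n < m) : stepSeq m a n = 1 := if_pos h

theorem stepSeq_self (m : ℕ) (a : L) : stepSeq m a m = a := by simp [stepSeq]

theorem stepSeq_of_gt {m n : ℕ} (a : L) (h : m < n) : stepSeq m a n = 0 := by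
  simp [stepSeq, h.not_gt, h.ne']

theorem consOne_stepSeq (m : ℕ) (a : L) : consOne (stepSeq m a) = stepSeq (m + 1) a := by
  funext n
  cases n <;> simp [consOne, stepSeq]

theorem stepSeqTwo_one (m : ℕ) (b : L) : stepSeqTwo m 1 b = stepSeq (m + 1) b := by
  funext n
  grind [stepSeqTwo, stepSeq]

theorem stepSeqTwo_zero (m : ℕ) (a : L) : stepSeqTwo m a 0 = stepSeq m a := by
  funext n
  grind [stepSeqTwo, stepSeq]

/-- The representation is not unique; cancellation has to allow for this overlap. -/
theorem stepSeq_one (m : ℕ) : stepSeq m (1 : L) = stepSeq (m + 1) 0 := by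
  rw [← stepSeqTwo_one, stepSeqTwo_zero]

theorem seqAdd_stepSeq (m n : ℕ) (a b : L) :
    seqAdd (stepSeq m a) (stepSeq n b) = stepSeqTwo (m + n) (plus a b) (a * b) := by
  funext i
  rw [seqAdd_eq_iterPlus, consOne_stepSeq, consOne_stepSeq, stepSeqTwo]
  have hz : ∀ j, m + 1 < i + 1 - j ∨ n + 1 < j →
      stepSeq (m + 1) a (i + 1 - j) * stepSeq (n + 1) b j = 0 := by
    rintro j (h | h)
    · rw [stepSeq_of_gt a h, bot_mul]
    · rw [stepSeq_of_gt b h, mul_bot]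
  split_ifs with h1 h2 h3
  -- At this index both factors still lie among the leading ones, so their product 1 absorbs the
  -- whole sum.
  · refine iterPlus_of_eq_one (p := min n (i + 1)) 0 (by omega) ?_
    rw [stepSeq_of_lt a (by omega), stepSeq_of_lt b (by omega), one_mul]
  · rw [iterPlus_eq_plus (p := n) (by omega) fun j _ h3 h4 => hz j (by omega),
      show i + 1 - n = m + 1 by omega, stepSeq_self, stepSeq_of_lt b (by omega), mul_one,
      stepSeq_of_lt a (by omega), stepSeq_self, one_mul]
  · rw [iterPlus_eq_plus (p := n) (by omega) fun j _ h3 h4 => hz j (by omega),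
      hz n (by omega), zero_plus, show i + 1 - (n + 1) = m + 1 by omega, stepSeq_self,
      stepSeq_self]
  · rw [iterPlus_of_eq_zero (p := 0) 0 (Nat.zero_le _) fun j _ _ => hz j (by omega), iterPlus]

/-- Proved in `L` itself, since bounds found separately in infinitely many factors need not be
uniform. -/
theorem seqAdd_eq_zero {a b : ℕ → L} {M N n : ℕ} (ha : ∀ n, M < n → a n = 0)
    (hb : ∀ n, N < n → b n = 0) (hn : M + N + 1 < n) : seqAdd a b n = 0 := by
  rw [seqAdd, hb n (by omega), plus_zero,
    iterPlus_of_eq_zero (p := 0) _ (Nat.zero_le _) fun j _ _ => ?_, iterPlus, ha n (by omega)]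
  by_cases hj : N < j
  · rw [hb j hj, mul_bot]
  · rw [ha _ (by omega), bot_mul]

theorem seqAdd_zero (a : ℕ → L) : seqAdd a (fun _ => 0) = a := by
  funext n
  rw [seqAdd, plus_zero, iterPlus_of_eq_zero (p := 0) _ (Nat.zero_le _) fun j _ _ => mul_bot _,
    iterPlus]

theorem isGoodSeq_zero : IsGoodSeq (fun _ => 0 : ℕ → L) :=
  ⟨fun _ => plus_zero 0, 0, fun _ _ => rfl⟩

end IterPlus

/-! ### Good sequences in chains of cancellative type -/

section Chain

variable {C : Type u} [BLAlgebra C]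

/-- An entry followed by a nonzero one must be 1, and an entry 0 is followed only by zeros. So only
the last entry before the first 0 is free. -/
theorem IsGoodSeq.exists_eq_stepSeq (hC : IsCancellativeChain C) {a : ℕ → C}
    (ha : IsGoodSeq a) : ∃ m x, a = stepSeq m x := by
  classical
  have hex : ∃ n, a n = 0 := ha.2.imp' (· + 1) fun N h => h _ (Nat.lt_succ_self N)
  have hz : ∀ n, Nat.find hex ≤ n → a n = 0 := by
    intro n hn
    induction n, hn using Nat.le_induction with
    | base => exact Nat.find_spec hex
    | succ n _ ih => rw [← zero_plus (a (n + 1)), ← ih, ha.1, ih]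
  have hone : ∀ n, n + 1 < Nat.find hex → a n = 1 := fun n hn =>
    (hC.plus_eq_left (ha.1 n)).resolve_right (Nat.find_min hex hn)
  cases hm : Nat.find hex with
  | zero =>
    refine ⟨0, 0, funext fun n => ?_⟩
    rw [hz n (by omega)]
    simp [stepSeq]
  | succ k =>
    refine ⟨k, a k, funext fun n => ?_⟩
    rcases lt_trichotomy n k with h | rfl | h
    · rw [stepSeq_of_lt _ h, hone n (by omega)]
    · rw [stepSeq_self]
    · rw [stepSeq_of_gt _ h, hz n (by omega)]

theorem isGoodSeq_stepSeqTwo {m : ℕ} {x y : C} (h : plus x y = x) :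
    IsGoodSeq (stepSeqTwo m x y) := by
  refine ⟨fun n => ?_, m + 1, fun n hn => ?_⟩
  · grind [stepSeqTwo, one_plus, plus_zero]
  · grind [stepSeqTwo]

theorem IsCancellativeChain.isGoodSeq_seqAdd (hC : IsCancellativeChain C) {a b : ℕ → C}
    (ha : IsGoodSeq a) (hb : IsGoodSeq b) : IsGoodSeq (seqAdd a b) := by
  obtain ⟨m, x, rfl⟩ := ha.exists_eq_stepSeq hC
  obtain ⟨n, y, rfl⟩ := hb.exists_eq_stepSeq hC
  rw [seqAdd_stepSeq]
  exact isGoodSeq_stepSeqTwo (hC.plus_plus_mul x y)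

theorem IsCancellativeChain.seqAdd_comm (hC : IsCancellativeChain C) {a b : ℕ → C}
    (ha : IsGoodSeq a) (hb : IsGoodSeq b) : seqAdd a b = seqAdd b a := by
  obtain ⟨m, x, rfl⟩ := ha.exists_eq_stepSeq hC
  obtain ⟨n, y, rfl⟩ := hb.exists_eq_stepSeq hC
  rw [seqAdd_stepSeq, seqAdd_stepSeq, plus_comm, mul_comm, add_comm]

/-- Since a + b = 1 or a ⊗ b = 0, the inner sum is again a step sequence, and one formula covers
both cases. -/
theorem IsCancellativeChain.seqAdd_stepSeq_stepSeq (hC : IsCancellativeChain C) (m n k i : ℕ)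
    (a b c : C) :
    seqAdd (seqAdd (stepSeq m a) (stepSeq n b)) (stepSeq k c) i =
      if i < m + n + k then 1 else if i = m + n + k then plus (plus a b) c else
      if i = m + n + k + 1 then plus (a * b) (plus a b * c) else
      if i = m + n + k + 2 then a * b * c else 0 := by
  rw [seqAdd_stepSeq]
  rcases hC.plus_eq_one_or_mul_eq_zero a b with h | h
  · rw [h, stepSeqTwo_one, seqAdd_stepSeq, one_plus, one_mul]
    grind [stepSeqTwo]
  · rw [h, stepSeqTwo_zero, seqAdd_stepSeq, zero_plus, bot_mul]
    grind [stepSeqTwo]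

theorem IsCancellativeChain.seqAdd_assoc (hC : IsCancellativeChain C) {a b c : ℕ → C}
    (ha : IsGoodSeq a) (hb : IsGoodSeq b) (hc : IsGoodSeq c) :
    seqAdd (seqAdd a b) c = seqAdd a (seqAdd b c) := by
  -- Commutativity turns the right side into (b + c) + a, so the formula for left-bracketed sums
  -- serves both sides.
  rw [hC.seqAdd_comm ha (hC.isGoodSeq_seqAdd hb hc)]
  obtain ⟨m, x, rfl⟩ := ha.exists_eq_stepSeq hC
  obtain ⟨n, y, rfl⟩ := hb.exists_eq_stepSeq hC
  obtain ⟨k, z, rfl⟩ := hc.exists_eq_stepSeq hC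
  funext i
  rw [hC.seqAdd_stepSeq_stepSeq, hC.seqAdd_stepSeq_stepSeq, hC.plus_assoc,
    plus_comm (plus y z), hC.mul_plus_plus_mul, mul_comm x (plus y z), mul_assoc, mul_comm x,
    show n + k + m = m + n + k by omega]

theorem IsCancellativeChain.stepSeq_eq_of_lt (hC : IsCancellativeChain C) {m n k : ℕ}
    {a b c : C} (hmn : m < n)
    (h : stepSeqTwo (m + k) (plus a c) (a * c) = stepSeqTwo (n + k) (plus b c) (b * c)) :
    stepSeq m a = stepSeq n b := by
  have h0 := congrFun h (m + k)
  have h1 := congrFun h (m + k + 1)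
  have h2 := congrFun h (m + k + 2)
  simp only [stepSeqTwo] at h0 h1 h2
  have h0' : plus a c = 1 := by grind
  obtain rfl | hn : n = m + 1 ∨ m + 1 < n := by omega
  -- Comparing entries, c ≤ b + c = a ⊗ c ≤ c. So c cannot tell b from 0 nor a from 1, which is
  -- exactly the overlap `stepSeq_one`.
  · have h1' : a * c = plus b c := by grind
    have h2' : b * c = 0 := by grind
    have h3 : a * c = c := le_antisymm (mul_le_right a c) (h1' ▸ le_plus_right b c)
    have hb : b = 0 := hC.2 c b 0 (by rw [plus_comm, ← h1', h3, plus_zero])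
      (by rw [mul_comm, h2', mul_bot])
    have ha : a = 1 := hC.2 c a 1 (by rw [plus_comm, h0', plus_one])
      (by rw [mul_comm, h3, mul_one])
    rw [ha, hb, stepSeq_one]
  -- A gap of at least two forces 0 = 1, which is possible because the one-element chain is
  -- admitted.
  · have h1' : a * c = 1 := by grind
    have ha : a = 1 := le_antisymm (le_one a) (h1' ▸ mul_le_left a c)
    have hc : c = 1 := le_antisymm (le_one c) (h1' ▸ mul_le_right a c)
    have h2' : (0 : C) = 1 := by grind [plus_one]
    exact funext fun i => eq_of_zero_eq_one h2' _ _

theorem IsCancellativeChain.seqAdd_right_cancel (hC : IsCancellativeChain C) {a b c : ℕ → C}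
    (ha : IsGoodSeq a) (hb : IsGoodSeq b) (hc : IsGoodSeq c)
    (h : seqAdd a c = seqAdd b c) : a = b := by
  obtain ⟨m, x, rfl⟩ := ha.exists_eq_stepSeq hC
  obtain ⟨n, y, rfl⟩ := hb.exists_eq_stepSeq hC
  obtain ⟨k, z, rfl⟩ := hc.exists_eq_stepSeq hC
  rw [seqAdd_stepSeq, seqAdd_stepSeq] at h
  rcases lt_trichotomy m n with hmn | rfl | hmn
  · exact hC.stepSeq_eq_of_lt hmn h
  · have h0 := congrFun h (m + k)
    have h1 := congrFun h (m + k + 1)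
    simp only [stepSeqTwo, lt_irrefl, if_true, if_false] at h0
    have h1' : x * z = y * z := by simpa [stepSeqTwo] using h1
    rw [hC.2 z x y (by rw [plus_comm, h0, plus_comm]) (by rw [mul_comm, h1', mul_comm])]
  · exact (hC.stepSeq_eq_of_lt hmn h.symm).symm

end Chain

/-! ### Homomorphisms and sequences -/

section Hom

variable {L C : Type u} [BLAlgebra L] [BLAlgebra C] {f : L → C}

theorem IsHom.map_plus (hf : IsHom f) (x y : L) : f (plus x y) = plus (f x) (f y) := by
  simp only [plus, meet, oslash, neg, hf.map_mul, hf.map_himp, hf.map_zero]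

theorem IsHom.map_iterPlus (hf : IsHom f) (x : L) (t : ℕ → L) (k : ℕ) :
    f (iterPlus x t k) = iterPlus (f x) (f ∘ t) k := by
  induction k with
  | zero => rfl
  | succ k ih => rw [iterPlus, iterPlus, hf.map_plus, ih, Function.comp_apply]

theorem IsHom.comp_seqAdd (hf : IsHom f) (a b : ℕ → L) :
    f ∘ seqAdd a b = seqAdd (f ∘ a) (f ∘ b) := by
  funext n
  simp only [Function.comp_apply, seqAdd, hf.map_plus, hf.map_iterPlus]
  congr 1
  exact iterPlus_congr _ fun j _ => hf.map_mul _ _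

theorem IsHom.isGoodSeq_comp (hf : IsHom f) {a : ℕ → L} (ha : IsGoodSeq a) :
    IsGoodSeq (f ∘ a) := by
  refine ⟨fun n => ?_, ha.2.imp fun N h n hn => ?_⟩
  · rw [Function.comp_apply, Function.comp_apply, ← hf.map_plus, ha.1]
  · rw [Function.comp_apply, h n hn, hf.map_zero]

end Hom

/-! ### From chains to algebras of cancellative type -/

section CancellativeType

variable {L : Type u} [BLAlgebra L]

/-- In an algebra of cancellative type, elements are separated by the homomorphisms to chains
of cancellative type. -/
theorem IsOfCancellativeType.ext (hL : IsOfCancellativeType L) {x y : L}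
    (h : ∀ (C : Type u) [BLAlgebra C] (f : L → C), IsCancellativeChain C → IsHom f → f x = f y) :
    x = y := by
  obtain ⟨ι, C, inst, π, hC, hπ, -, hinj⟩ := hL
  exact hinj (funext fun i => h (C i) (π i) (hC i) (hπ i))

theorem IsOfCancellativeType.seq_ext (hL : IsOfCancellativeType L) {a b : ℕ → L}
    (h : ∀ (C : Type u) [BLAlgebra C] (f : L → C), IsCancellativeChain C → IsHom f →
      f ∘ a = f ∘ b) : a = b :=
  funext fun n => hL.ext fun C _ f hC hf => congrFun (h C f hC hf) n

theorem IsOfCancellativeType.isGoodSeq_seqAdd (hL : IsOfCancellativeType L) {a b : ℕ → L}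
    (ha : IsGoodSeq a) (hb : IsGoodSeq b) : IsGoodSeq (seqAdd a b) := by
  refine ⟨fun n => hL.ext fun C _ f hC hf => ?_, ?_⟩
  · have h := (hC.isGoodSeq_seqAdd (hf.isGoodSeq_comp ha) (hf.isGoodSeq_comp hb)).1 n
    rw [← hf.comp_seqAdd] at h
    rw [hf.map_plus]
    exact h
  · obtain ⟨M, hM⟩ := ha.2
    obtain ⟨N, hN⟩ := hb.2
    exact ⟨M + N + 1, fun n hn => seqAdd_eq_zero hM hN hn⟩

theorem IsOfCancellativeType.seqAdd_comm (hL : IsOfCancellativeType L) {a b : ℕ → L}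
    (ha : IsGoodSeq a) (hb : IsGoodSeq b) : seqAdd a b = seqAdd b a :=
  hL.seq_ext fun C _ f hC hf => by
    rw [hf.comp_seqAdd, hf.comp_seqAdd,
      hC.seqAdd_comm (hf.isGoodSeq_comp ha) (hf.isGoodSeq_comp hb)]

theorem IsOfCancellativeType.seqAdd_assoc (hL : IsOfCancellativeType L) {a b c : ℕ → L}
    (ha : IsGoodSeq a) (hb : IsGoodSeq b) (hc : IsGoodSeq c) :
    seqAdd (seqAdd a b) c = seqAdd a (seqAdd b c) :=
  hL.seq_ext fun C _ f hC hf => by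
    simp only [hf.comp_seqAdd]
    exact hC.seqAdd_assoc (hf.isGoodSeq_comp ha) (hf.isGoodSeq_comp hb) (hf.isGoodSeq_comp hc)

theorem IsOfCancellativeType.seqAdd_right_cancel (hL : IsOfCancellativeType L) {a b c : ℕ → L}
    (ha : IsGoodSeq a) (hb : IsGoodSeq b) (hc : IsGoodSeq c)
    (h : seqAdd a c = seqAdd b c) : a = b :=
  hL.seq_ext fun C _ f hC hf => by
    refine hC.seqAdd_right_cancel (hf.isGoodSeq_comp ha) (hf.isGoodSeq_comp hb)
      (hf.isGoodSeq_comp hc) ?_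
    rw [← hf.comp_seqAdd, h, hf.comp_seqAdd]

/-- The good sequences of an algebra of cancellative type form a cancellative commutative
monoid. -/
abbrev IsOfCancellativeType.addCancelCommMonoid (hL : IsOfCancellativeType L) :
    AddCancelCommMonoid (GoodSeq L) :=
  have comm (a b : GoodSeq L) : (⟨seqAdd a.1 b.1, hL.isGoodSeq_seqAdd a.2 b.2⟩ : GoodSeq L) =
      ⟨seqAdd b.1 a.1, hL.isGoodSeq_seqAdd b.2 a.2⟩ := Subtype.ext (hL.seqAdd_comm a.2 b.2)
  { add := fun a b => ⟨seqAdd a.1 b.1, hL.isGoodSeq_seqAdd a.2 b.2⟩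
    zero := ⟨fun _ => 0, isGoodSeq_zero⟩
    add_assoc := fun a b c => Subtype.ext (hL.seqAdd_assoc a.2 b.2 c.2)
    add_zero := fun a => Subtype.ext (seqAdd_zero a.1)
    zero_add := fun a => (comm _ a).trans (Subtype.ext (seqAdd_zero a.1))
    add_comm := comm
    nsmul := @nsmulRec _ ⟨⟨fun _ => 0, isGoodSeq_zero⟩⟩ ⟨fun a b => ⟨seqAdd a.1 b.1, hL.isGoodSeq_seqAdd a.2 b.2⟩⟩
    add_left_cancel := fun a b c h => Subtype.ext <|
      hL.seqAdd_right_cancel b.2 c.2 a.2 <| congrArg Subtype.val <|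
        (comm b a).trans (h.trans (comm a c)) }

end CancellativeType

end BLAlgebra

/-- For `L` of cancellative type, the good sequences of `L` under addition of sequences, with
neutral element the zero sequence, form a cancellative (commutative) monoid. -/
theorem proposition5p6 (L : Type u) [BLAlgebra L] (hL : BLAlgebra.IsOfCancellativeType L) :
    ∃ _inst : AddCancelCommMonoid (BLAlgebra.GoodSeq L),
      (∀ a b : BLAlgebra.GoodSeq L, (a + b).1 = BLAlgebra.seqAdd a.1 b.1) ∧
      (0 : BLAlgebra.GoodSeq L).1 = fun _ => 0 :=
  ⟨hL.addCancelCommMonoid, fun _ _ => rfl, rfl⟩
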